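/- Let $\Gamma$ be a finite connected graph with oriented edges. A morphism $f\colon\Gamma\to\Gamma$ maps vertices to vertices and each edge $e$ to an edge-path from $f(\mathsf o(e))$ to $f(\mathsf t(e))$. Let $f$ be a morphism that is a homotopy equivalence and fixes a vertex $*$, and let $H\subset\Gamma$ be a subgraph with $f(H)\subseteq H$. Put $\mathbb F=\pi_1(\Gamma,*)$, let $\widetilde\Gamma$ be the universal cover, $\widetilde H\subset\widetilde\Gamma$ the preimage of $H$, and $\tilde f$ the lift of $f$ fixing a chosen lift of $*$; $\mathbb F$ acts on $\widetilde\Gamma$ by deck transformations. Let $A_f$ be the map induced by $\tilde f$ on $C_1(\widetilde\Gamma;\mathbb Q)$, let $C_1(\widetilde\Gamma,\widetilde H;\mathbb Q)$ be the $\mathbb Q[\mathbb F]$-submodule of chains $x=\sum x_e e$ with $x_e=0$ for all $e\in\mathsf E(\widetilde H)$, let $\pi_H^\perp$ be the coordinate projection of $C_1(\widetilde\Gamma;\mathbb Q)$ onto it, and put $A=A_{f,H}=\pi_H^\perp\circ A_f|_{C_1(\widetilde\Gamma,\widetilde H;\mathbb Q)}$. Write $\langle x,x'\rangle=\sum_e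 x_ex'_e$, $\|x\|^2=\langle x,x\rangle$ and $\operatorname{supp}(x)=\{e: x_e\ne0\}$. A \emph{Nielsen 1-chain} is a chain $\rho=\pi_H^\perp([u,v])$, where $u\neq v$ are vertices of $\widetilde\Gamma$ fixed by $\tilde f$ and $[u,v]$ is the unique 1-chain with boundary $v-u$, that satisfies one of the following. (Non-geometric) There is an edge $e\in\mathsf E(\widetilde\Gamma)-\mathsf E(\widetilde H)$ with $\rho_e=\pm1$ and $\rho_{ge}=0$ for all $1\neq g\in\mathbb F$. (Geometric) For distinct $g_1,g_2\in\mathbb F$ the set $\operatorname{supp}(g_1\rho)\cap\operatorname{supp}(g_2\rho)$ has at most one element; for every edge $e\in\mathsf E(\widetilde\Gamma)-\mathsf E(\widetilde H)$ there is exactly one unordered pair of distinct elements $g_1,g_2\in\mathbb F$ with $\operatorname{supp}(g_1\rho)\cap\operatorname{supp}(g_2\rho)=\{e\}$; and there are non-commuting $g_1,g_2\in\mathbb F$ such that $\operatorname{supp}(\rho)\cap\operatorname{supp}(g_i\rho)\neq\emptyset$ for $i=1,2$. Suppose that $f$ satisfies the \emph{chain flare condition} relative to $H$ with $\mathbb Q[\mathbb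 F]$-submodules $V_{\rm h},V_{\rm qf}\subseteq C_1(\widetilde\Gamma,\widetilde H;\mathbb Q)$, that is: (1) $C_1(\widetilde\Gamma,\widetilde H;\mathbb Q)=V_{\rm h}+V_{\rm qf}$. (2) There are $\lambda_0>1$ and $0<\theta<1$ with $\lambda_0\|A(x)\|\le\max\{\|A^2(x)\|,\|x\|\}$ for all $x\in N_\theta(V_{\rm h})^\infty$. Here $N_\theta(V_{\rm h})$ is the set of all $x'\in C_1(\widetilde\Gamma,\widetilde H;\mathbb Q)$ with $\langle x,x'\rangle>\theta\|x\|\|x'\|$ for some $x\in V_{\rm h}$, and $N^\infty=\bigcup_{k\in\mathbb Z}A^k(N)$, where for $k<0$ the set $A^{k}(N)$ is the preimage of $N$ under $A^{-k}$. (3) If $V_{\rm qf}\neq\{0\}$, then there is a Nielsen 1-chain $\rho$ such that every $x\in V_{\rm qf}$ is of the form $q_1g_1\rho+\dots+q_rg_r\rho$ with $q_i\in\mathbb Q$, $g_i\in\mathbb F$. Let $C_1^{(2)}(\widetilde\Gamma,\widetilde H)$ be the Hilbert space of square-summable complex 1-chains on the edges of $\widetilde\Gamma$ outside $\widetilde H$;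 it is isomorphic to $L^2(\mathbb F)^{n_H}$, where $n_H$ is the number of edges of $\Gamma$ outside $H$. Let $V_{\rm qf}^{(2)}$ be the closure in it of the complex span of $V_{\rm qf}$. For a bounded operator $B$ on a Hilbert space $\mathcal H$ and $\nu>0$ let $$\mathfrak E(B,\nu)=\{\xi\in\mathcal H:\exists(\xi_j)\subset\mathcal H,\ \xi_j\to\xi,\ \limsup_{j\to\infty}\|B^j\xi_j\|^{1/j}\le\nu\},$$ $$\mathfrak F(B,\nu)=\{\xi\in\mathcal H:\exists(\xi_j)\subset\mathcal H,\ B^j\xi_j\to\xi,\ \limsup_{j\to\infty}\|\xi_j\|^{1/j}\le\nu^{-1}\}.$$ Then $A_{f,H}$ extends uniquely to a bounded operator on $C_1^{(2)}(\widetilde\Gamma,\widetilde H)$, again denoted $A_{f,H}$, and there is a constant $\lambda>1$ such that for all $1\le\nu<\lambda$ $$V_{\rm qf}^{(2)}=\mathfrak E(A_{f,H},\nu)\cap\mathfrak F(A_{f,H},\nu^{-1}).$$ -/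

import Mathlib

open CategoryTheory
open scoped ENNReal

universe u v

noncomputable section

namespace ChainFlare

/-! ### Graphs, morphisms of graphs and homotopy equivalences

A graph is a quiver: objects are vertices and arrows are the (oriented) edges.  The free
groupoid on the quiver is the fundamental groupoid of the graph: its arrows are the homotopy
classes rel endpoints of edge-paths. -/

section Graphs

variable (V : Type u) [Quiver.{v} V]

/-- The fundamental groupoid of the graph. -/
abbrev Pi1 : Type u := Quiver.FreeGroupoid V

variable {V}

/-- Edge-paths starting at the vertex `a`: concatenations of edges and reversed edges. -/
inductive EdgePath (a : V) : V → Type (max u v)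
  | nil : EdgePath a a
  | forward {b c : V} (p : EdgePath a b) (e : b ⟶ c) : EdgePath a c
  | backward {b c : V} (p : EdgePath a b) (e : c ⟶ b) : EdgePath a c

variable (V) in
/-- A morphism of a graph to itself: vertices go to vertices and each edge goes to an edge-path. -/
structure GraphMap where
  obj : V → V
  map : ∀ {a b : V}, (a ⟶ b) → EdgePath (obj a) (obj b)

/-- A vertex, as an object of the fundamental groupoid. -/
abbrev pt (a : V) : Pi1 V := (Quiver.FreeGroupoid.of V).obj a

/-- The homotopy classes rel endpoints of edge-paths from `a` to `b`. -/
abbrev PathClass (a b : V) : Type (max u v) :=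
  @Quiver.Hom (Pi1 V) CategoryStruct.toQuiver (pt a) (pt b)

/-- The homotopy class rel endpoints of an edge. -/
abbrev edgeClass {a b : V} (e : a ⟶ b) : PathClass a b := (Quiver.FreeGroupoid.of V).map e

/-- The homotopy class rel endpoints of an edge-path. -/
def pathClass {a : V} : ∀ {b : V}, EdgePath a b → PathClass a b
  | _, .nil => 𝟙 (pt a)
  | _, .forward p e => pathClass p ≫ edgeClass e
  | _, .backward p e => pathClass p ≫ Groupoid.inv (edgeClass e)

/-- The functor induced on fundamental groupoids by a morphism of the graph. -/
def GraphMap.induced (f : GraphMap V) : Pi1 V ⥤ Pi1 V :=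
  Quiver.FreeGroupoid.lift
    { obj := fun a => pt (f.obj a)
      map := fun e => pathClass (f.map e) }

/-- The induced functor on arrows. -/
def GraphMap.mapClass (f : GraphMap V) {a b : V} (p : PathClass a b) :
    PathClass (f.obj a) (f.obj b) :=
  f.induced.map p

/-- `f` is a homotopy equivalence.  A homotopy between two morphisms of a graph is, up to homotopy
rel endpoints, a choice for each vertex of a path between its two images that is compatible with
the images of all edges; this is an isomorphism of the induced functors. -/
def GraphMap.IsHomotopyEquiv (f : GraphMap V) : Prop :=
  ∃ g : GraphMap V, Nonempty (f.induced ⋙ g.induced ≅ 𝟭 (Pi1 V)) ∧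
    Nonempty (g.induced ⋙ f.induced ≅ 𝟭 (Pi1 V))

variable (V)

/-- A subgraph. -/
structure Subgraph where
  verts : Set V
  edges : ∀ {a b : V}, Set (a ⟶ b)
  src_mem : ∀ {a b : V} {e : a ⟶ b}, e ∈ edges → a ∈ verts
  tgt_mem : ∀ {a b : V} {e : a ⟶ b}, e ∈ edges → b ∈ verts

variable {V}

/-- The edge-path only crosses edges of `H` (in either direction) and starts in `H`. -/
def Subgraph.ContainsPath (H : Subgraph V) {a : V} : ∀ {b : V}, EdgePath a b → Prop
  | _, .nil => a ∈ H.verts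
  | _, .forward p e => H.ContainsPath p ∧ e ∈ H.edges
  | _, .backward p e => H.ContainsPath p ∧ e ∈ H.edges

/-- `f(H) ⊆ H`. -/
def Subgraph.IsInvariant (H : Subgraph V) (f : GraphMap V) : Prop :=
  (∀ a ∈ H.verts, f.obj a ∈ H.verts) ∧
    ∀ (a b : V) (e : a ⟶ b), e ∈ H.edges → H.ContainsPath (f.map e)

end Graphs

/-! ### The universal cover

The universal cover of the graph based at the vertex `x`: a vertex is a homotopy class of
edge-paths starting at `x`, and an edge is an edge of the graph together with a lift of its initial
vertex.  The fundamental group at `x` is the set of loops `PathClass x x` with concatenation `≫` as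
product; it acts on the left by concatenation. -/

section Cover

variable {V : Type u} [Quiver.{v} V]

/-- The vertices of the universal cover. -/
@[ext]
structure CoverVertex (x : V) where
  base : V
  path : PathClass x base

/-- The edges of the universal cover; `path` is the initial vertex. -/
@[ext]
structure CoverEdge (x : V) where
  src : V
  tgt : V
  edge : src ⟶ tgt
  path : PathClass x src

variable {x : V}

def CoverEdge.initial (e : CoverEdge x) : CoverVertex x := ⟨e.src, e.path⟩

def CoverEdge.terminal (e : CoverEdge x) : CoverVertex x := ⟨e.tgt, e.path ≫ edgeClass e.edge⟩

/-- The action of the fundamental group on the edges of the universal cover. -/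
def CoverEdge.translate (g : PathClass x x) (e : CoverEdge x) : CoverEdge x :=
  ⟨e.src, e.tgt, e.edge, g ≫ e.path⟩

/-- Rational cellular `1`-chains of the universal cover. -/
abbrev Chain1 (x : V) := CoverEdge x →₀ ℚ

/-- Rational cellular `0`-chains of the universal cover. -/
abbrev Chain0 (x : V) := CoverVertex x →₀ ℚ

/-- The boundary map, `e ↦ t(e) - o(e)`. -/
def boundary : Chain1 x →ₗ[ℚ] Chain0 x :=
  Finsupp.linearCombination ℚ fun e =>
    Finsupp.single e.terminal (1 : ℚ) - Finsupp.single e.initial 1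

/-- The `1`-chain of the lift to the universal cover, with initial vertex `s`, of an edge-path. -/
def pathChain {a : V} (s : PathClass x a) : ∀ {b : V}, EdgePath a b → Chain1 x
  | _, .nil => 0
  | _, .forward (b := b) (c := c) p e =>
      pathChain s p + Finsupp.single ⟨b, c, e, s ≫ pathClass p⟩ 1
  | _, .backward (b := b) (c := c) p e =>
      pathChain s p - Finsupp.single ⟨c, b, e, s ≫ pathClass p ≫ Groupoid.inv (edgeClass e)⟩ 1

/-- For `f` fixing `x`, the action of the lift of `f` that fixes the base point of the universal
cover on (paths representing) vertices of the universal cover. -/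
def liftPath (f : GraphMap V) (hx : f.obj x = x) {a : V} (p : PathClass x a) :
    PathClass x (f.obj a) :=
  eqToHom (congrArg (fun a : V => pt a) hx.symm) ≫ f.mapClass p

/-- The lift of `f` on vertices of the universal cover. -/
def liftVertex (f : GraphMap V) (hx : f.obj x = x) (w : CoverVertex x) : CoverVertex x :=
  ⟨f.obj w.base, liftPath f hx w.path⟩

/-- The map induced on `1`-chains by the lift of `f`. -/
def chainMap (f : GraphMap V) (hx : f.obj x = x) : Chain1 x →ₗ[ℚ] Chain1 x :=
  Finsupp.linearCombination ℚ fun e => pathChain (liftPath f hx e.path) (f.map e.edge)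

end Cover

/-! ### Relative chains -/

section Relative

variable {V : Type u} [Quiver.{v} V]

/-- The edges of the universal cover that do not project to edges of `H`. -/
abbrev RelEdge (H : Subgraph V) (x : V) := {e : CoverEdge x // e.edge ∉ H.edges}

/-- The relative rational `1`-chains, i.e. those supported on the edges outside the preimage
of `H`. -/
abbrev RelChain (H : Subgraph V) (x : V) := RelEdge H x →₀ ℚ

variable {H : Subgraph V} {x : V}

def RelEdge.translate (g : PathClass x x) (e : RelEdge H x) : RelEdge H x :=
  ⟨e.1.translate g, e.2⟩

/-- The action of the fundamental group on relative chains, `e ↦ g e` on edges. -/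
def RelChain.translate (g : PathClass x x) : RelChain H x →ₗ[ℚ] RelChain H x :=
  Finsupp.lmapDomain ℚ ℚ (RelEdge.translate g)

variable (H x) in
/-- The inclusion of relative chains into all chains. -/
def relIncl : RelChain H x →ₗ[ℚ] Chain1 x := Finsupp.lmapDomain ℚ ℚ Subtype.val

variable (H x) in
/-- The projection of chains onto relative chains, forgetting the coefficients of edges over
`H`. -/
def relProj : Chain1 x →ₗ[ℚ] RelChain H x :=
  Finsupp.lcomapDomain (Subtype.val : RelEdge H x → CoverEdge x) Subtype.val_injective

variable (H) in
/-- The map `A_{f,H}` on relative rational chains. -/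
def relMap (f : GraphMap V) (hx : f.obj x = x) : RelChain H x →ₗ[ℚ] RelChain H x :=
  relProj H x ∘ₗ chainMap f hx ∘ₗ relIncl H x

/-- The usual inner product of chains. -/
def chainInner (c d : RelChain H x) : ℝ := ∑ e ∈ c.support, (c e : ℝ) * (d e : ℝ)

/-- The usual `L²`-norm of chains. -/
def chainNorm (c : RelChain H x) : ℝ := √(chainInner c c)

/-- `ρ` is the relative chain of the edge-path between two distinct vertices of the universal cover
that are fixed by the lift of `f`. -/
def IsFixedPathChain (f : GraphMap V) (hx : f.obj x = x) (ρ : RelChain H x) : Prop :=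
  ∃ (w w' : CoverVertex x) (c : Chain1 x), w ≠ w' ∧
    liftVertex f hx w = w ∧ liftVertex f hx w' = w' ∧
    boundary c = Finsupp.single w' 1 - Finsupp.single w 1 ∧ ρ = relProj H x c

/-- The condition that distinguishes non-geometric Nielsen `1`-chains. -/
def IsNonGeometric (ρ : RelChain H x) : Prop :=
  ∃ e : RelEdge H x, (ρ e = 1 ∨ ρ e = -1) ∧
    ∀ g : PathClass x x, g ≠ 𝟙 (pt x) → ρ (e.translate g) = 0

/-- The support of the translate `gρ`. -/
def suppTranslate (g : PathClass x x) (ρ : RelChain H x) : Set (RelEdge H x) :=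
  {e | RelChain.translate g ρ e ≠ 0}

/-- The conditions that distinguish geometric Nielsen `1`-chains. -/
structure IsGeometric (ρ : RelChain H x) : Prop where
  /-- The supports of two different translates share at most one edge. -/
  single : ∀ g₁ g₂ : PathClass x x, g₁ ≠ g₂ →
    (suppTranslate g₁ ρ ∩ suppTranslate g₂ ρ).Subsingleton
  /-- Every edge is the common edge of exactly one pair of different translates. -/
  pair : ∀ e : RelEdge H x, ∃ g₁ g₂ : PathClass x x, g₁ ≠ g₂ ∧
    suppTranslate g₁ ρ ∩ suppTranslate g₂ ρ = {e} ∧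
    ∀ h₁ h₂ : PathClass x x, h₁ ≠ h₂ → suppTranslate h₁ ρ ∩ suppTranslate h₂ ρ = {e} →
      (h₁ = g₁ ∧ h₂ = g₂) ∨ (h₁ = g₂ ∧ h₂ = g₁)
  noncommuting : ∃ g₁ g₂ : PathClass x x, g₁ ≫ g₂ ≠ g₂ ≫ g₁ ∧
    (suppTranslate (𝟙 (pt x)) ρ ∩ suppTranslate g₁ ρ).Nonempty ∧
    (suppTranslate (𝟙 (pt x)) ρ ∩ suppTranslate g₂ ρ).Nonempty

/-- Nielsen `1`-chains. -/
def IsNielsenChain (f : GraphMap V) (hx : f.obj x = x) (ρ : RelChain H x) : Prop :=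
  IsFixedPathChain f hx ρ ∧ (IsNonGeometric ρ ∨ IsGeometric ρ)

/-! ### The chain flare condition -/

/-- `N_θ(W)`: the chains that make a small angle with some element of `W`. -/
def angleNhd (θ : ℝ) (W : Submodule ℚ (RelChain H x)) : Set (RelChain H x) :=
  {d | ∃ c ∈ W, chainInner c d > θ * chainNorm c * chainNorm d}

/-- `⋃ₖ Aᵏ(N)` over all integers `k`; for negative `k` this is the preimage of `N` under `A⁻ᵏ`. -/
def orbitSet {M : Type*} (A : M → M) (N : Set M) : Set M :=
  ⋃ k : ℕ, (A^[k] '' N ∪ A^[k] ⁻¹' N)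

/-- A rational subspace is a submodule over the rational group ring of the fundamental group. -/
def IsGroupInvariant (W : Submodule ℚ (RelChain H x)) : Prop :=
  ∀ (g : PathClass x x), ∀ c ∈ W, RelChain.translate g c ∈ W

/-- `f` satisfies the chain flare condition relative to `H` with hyperbolic submodule `Vh` and
quasi-fixed submodule `Vqf`. -/
structure ChainFlareCondition (f : GraphMap V) (hx : f.obj x = x)
    (Vh Vqf : Submodule ℚ (RelChain H x)) : Prop where
  invariant_h : IsGroupInvariant Vh
  invariant_qf : IsGroupInvariant Vqf
  sum_eq_top : Vh ⊔ Vqf = ⊤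
  flare : ∃ lam θ : ℝ, 1 < lam ∧ 0 < θ ∧ θ < 1 ∧
    ∀ c ∈ orbitSet (relMap H f hx) (angleNhd θ Vh),
      lam * chainNorm (relMap H f hx c) ≤
        max (chainNorm (relMap H f hx (relMap H f hx c))) (chainNorm c)
  quasi_fixed : Vqf ≠ ⊥ → ∃ ρ : RelChain H x, IsNielsenChain f hx ρ ∧
    ∀ c ∈ Vqf, c ∈ Submodule.span ℚ (Set.range fun g : PathClass x x => RelChain.translate g ρ)

/-! ### `L²`-chains -/

variable (H x) in
/-- The Hilbert space of complex square-summable relative `1`-chains.  As the fundamental group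
acts freely on the edges of the universal cover with `n_H` orbits outside the preimage of `H`, a
choice of orbit representatives identifies it with `L²(𝔽)^{n_H}`. -/
abbrev L2Chain := lp (fun _ : RelEdge H x => ℂ) 2

/-- A rational chain, as an `L²`-chain. -/
def toL2 (c : RelChain H x) : L2Chain H x :=
  ⟨fun e => ((c e : ℚ) : ℂ), by
    refine memℓp_gen (summable_of_hasFiniteSupport ?_)
    refine c.hasFiniteSupport.subset fun e he => ?_
    contrapose! he
    simp [Function.notMem_support.mp he]⟩

/-- The Hilbert module of `W`: the closed complex subspace generated by `W`. -/
def l2Closure (W : Submodule ℚ (RelChain H x)) : Submodule ℂ (L2Chain H x) :=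
  (Submodule.span ℂ (toL2 '' (W : Set (RelChain H x)))).topologicalClosure

/-- The bounded operator `A` is the extension of `A_{f,H}` to `L²`-chains. -/
def IsL2Extension (f : GraphMap V) (hx : f.obj x = x) (A : L2Chain H x →L[ℂ] L2Chain H x) : Prop :=
  ∀ c : RelChain H x, A (toL2 c) = toL2 (relMap H f hx c)

end Relative

/-! ### Haagerup–Schultz subspaces -/

section HaagerupSchultz

variable {E : Type*} [NormedAddCommGroup E] [InnerProductSpace ℂ E]

/-- `𝔈(A, ν)`. -/
def subspaceE (A : E →L[ℂ] E) (ν : ℝ) : Set E :=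
  {ξ | ∃ s : ℕ → E, Filter.Tendsto s Filter.atTop (nhds ξ) ∧
    Filter.limsup (fun j : ℕ => ‖(A ^ j) (s j)‖ₑ ^ (1 / (j : ℝ))) Filter.atTop
      ≤ ENNReal.ofReal ν}

/-- `𝔉(A, ν)`. -/
def subspaceF (A : E →L[ℂ] E) (ν : ℝ) : Set E :=
  {ξ | ∃ s : ℕ → E, Filter.Tendsto (fun j : ℕ => (A ^ j) (s j)) Filter.atTop (nhds ξ) ∧
    Filter.limsup (fun j : ℕ => ‖s j‖ₑ ^ (1 / (j : ℝ))) Filter.atTop ≤ ENNReal.ofReal ν⁻¹}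

end HaagerupSchultz

end ChainFlare

end

/-!
A Nielsen chain `ρ` joins two vertices fixed by the lift of `f`. A tree has no cycles, so `ρ` is
fixed by `A`, and `A` permutes its translates because the endomorphism of `π₁` induced by `f` is
bijective. Thus all vectors in the span of the translates have bounded forward orbits and bounded
sequences of preimages, and a diagonal argument puts the closure of that span into
`𝔈(A, ν) ∩ 𝔉(A, ν⁻¹)`.

Conversely, let `ξ` lie in this intersection. Since `π₁` acts freely with finitely many orbits on
the edges, equivariant maps of rational chains are bounded, so the decomposition `V_h + V_qf` yields
a bounded operator that splits `ξ = η + ζ` with `η` in the closure of `V_h` and `ζ` in that of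
`V_qf`, and `η` again lies in the intersection. Suppose `η ≠ 0`. The orbits that approximate `η`
meet the cone around `V_h`, so by the flare condition their norms grow exponentially in one of the
two directions of time at least at the rate `lam > 1`. Slow forward growth excludes expansion at
`η`, i.e. gives `lam * ‖A η‖ ≤ ‖η‖`, and slow backward growth excludes contraction, i.e. gives
`lam * ‖η‖ ≤ ‖A η‖`; together these contradict `η ≠ 0`.
-/

noncomputable section

namespace ChainFlare

/-! ### Flaring sequences and slow vectors -/

section Flaring

variable {lam : ℝ} {a : ℕ → ℝ}

/-- The flare inequality for a sequence of norms: up to the factor `lam`, each term is dominated by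
one of its two neighbours. -/
def IsFlaring (lam : ℝ) (a : ℕ → ℝ) : Prop :=
  ∀ k, lam * a (k + 1) ≤ max (a (k + 2)) (a k)

theorem IsFlaring.pow_mul_le_of_lt (ha : IsFlaring lam a) (hlam : 1 < lam) (h0 : ∀ k, 0 ≤ a k)
    (h : a 0 < lam * a 1) (k : ℕ) : lam ^ k * a 1 ≤ a (k + 1) := by
  induction k generalizing a with
  | zero => simp
  | succ k ih =>
    have h1 : 0 < a 1 := pos_of_mul_pos_right ((h0 0).trans_lt h) (by linarith)
    have h2 : lam * a 1 ≤ a 2 := (le_max_iff.1 (ha 0)).resolve_right h.not_ge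
    have h3 : 0 < a 2 := (by positivity : 0 < lam * a 1).trans_le h2
    have hshift : lam ^ k * a 2 ≤ a (k + 2) :=
      ih (a := fun i => a (i + 1)) (fun i => ha (i + 1)) (fun i => h0 (i + 1))
        (by linarith [lt_mul_of_one_lt_left h1 hlam, lt_mul_of_one_lt_left h3 hlam])
    calc lam ^ (k + 1) * a 1 = lam ^ k * (lam * a 1) := by ring
      _ ≤ lam ^ k * a 2 := by gcongr
      _ ≤ a (k + 2) := hshift

theorem IsFlaring.pow_mul_le_zero (ha : IsFlaring lam a) (hlam : 1 < lam) (h0 : ∀ k, 0 ≤ a k)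
    (j : ℕ) (h : a (j + 1) < lam * a j) : lam ^ j * a j ≤ a 0 := by
  induction j with
  | zero => simp
  | succ j ih =>
    have h1 : 0 < a (j + 1) := pos_of_mul_pos_right ((h0 _).trans_lt h) (by linarith)
    have h2 : lam * a (j + 1) ≤ a j := (le_max_iff.1 (ha j)).resolve_left h.not_ge
    have h3 : 0 < a j := (by positivity : 0 < lam * a (j + 1)).trans_le h2
    calc lam ^ (j + 1) * a (j + 1) = lam ^ j * (lam * a (j + 1)) := by ring
      _ ≤ lam ^ j * a j := by gcongr
      _ ≤ a 0 := ih (by linarith [lt_mul_of_one_lt_left h1 hlam, lt_mul_of_one_lt_left h3 hlam])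

end Flaring

open Filter Topology Asymptotics

section Growth

variable {E : Type*}

theorem isLittleO_pow_of_limsup_le [SeminormedAddCommGroup E] {r : ℕ → E} {ν lam : ℝ}
    (hlam : 0 < lam) (hν : ν < lam)
    (h : limsup (fun j : ℕ => ‖r j‖ₑ ^ (1 / (j : ℝ))) atTop ≤ ENNReal.ofReal ν) :
    r =o[atTop] fun j => lam ^ j := by
  obtain ⟨μ, hμ, hμlam⟩ := exists_between (max_lt hν hlam)
  obtain ⟨hνμ, hμ0⟩ := max_lt_iff.1 hμ
  have hroot : ∀ᶠ j : ℕ in atTop, ‖r j‖ₑ ^ (1 / (j : ℝ)) < ENNReal.ofReal μ :=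
    eventually_lt_of_limsup_lt (h.trans_lt ((ENNReal.ofReal_lt_ofReal_iff hμ0).2 hνμ))
  suffices hbound : ∀ᶠ j in atTop, ‖r j‖ ≤ μ ^ j from
    (IsBigO.of_bound' (hbound.mono fun j hj => hj.trans (le_abs_self _))).trans_isLittleO
      (isLittleO_pow_pow_of_lt_left hμ0.le hμlam)
  filter_upwards [hroot, eventually_gt_atTop 0] with j hj hj0
  rw [one_div, ← ENNReal.lt_rpow_inv_iff (by positivity), inv_inv, ENNReal.rpow_natCast,
    ← ENNReal.ofReal_pow hμ0.le, ← ofReal_norm] at hj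
  exact ((ENNReal.ofReal_lt_ofReal_iff (by positivity)).1 hj).le

theorem limsup_enorm_rpow_le_one [SeminormedAddCommGroup E] {r : ℕ → E}
    (h : ∀ᶠ j : ℕ in atTop, ‖r j‖ ≤ j) :
    limsup (fun j : ℕ => ‖r j‖ₑ ^ (1 / (j : ℝ))) atTop ≤ 1 := by
  have hroot : Tendsto (fun j : ℕ => ENNReal.ofReal ((j : ℝ) ^ (1 / (j : ℝ)))) atTop (𝓝 1) := by
    simpa using ENNReal.tendsto_ofReal (tendsto_rpow_div.comp tendsto_natCast_atTop_atTop)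
  refine (limsup_le_limsup (h.mono fun j hj => ?_)).trans hroot.limsup_eq.le
  rw [← ofReal_norm, ENNReal.ofReal_rpow_of_nonneg (norm_nonneg _) (by positivity)]
  exact ENNReal.ofReal_le_ofReal (Real.rpow_le_rpow (norm_nonneg _) hj (by positivity))

theorem exists_seq_mem_tendsto_of_mem_closure [PseudoMetricSpace E] {S : ℕ → Set E}
    (hS : ∀ j, (S j).Nonempty) {ξ : E} (hξ : ξ ∈ closure {y | ∀ᶠ j in atTop, y ∈ S j}) :
    ∃ s : ℕ → E, (∀ j, s j ∈ S j) ∧ Tendsto s atTop (𝓝 ξ) := by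
  have hnear (j : ℕ) : ∃ y ∈ S j, dist ξ y < Metric.infDist ξ (S j) + 1 / ((j : ℝ) + 1) :=
    (Metric.infDist_lt_iff (hS j)).1 (lt_add_of_pos_right _ Nat.one_div_pos_of_nat)
  choose s hs hdist using hnear
  refine ⟨s, hs, Metric.tendsto_nhds.2 fun ε hε => ?_⟩
  obtain ⟨y, hy, hyξ⟩ := Metric.mem_closure_iff.1 hξ (ε / 2) (half_pos hε)
  filter_upwards [hy, tendsto_one_div_add_atTop_nhds_zero_nat.eventually
    (gt_mem_nhds (half_pos hε))] with j hyj hj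
  rw [dist_comm]
  linarith [hdist j, Metric.infDist_le_dist_of_mem (x := ξ) hyj]

end Growth

section SlowVectors

variable {𝕜 E : Type*} [NormedField 𝕜] [SeminormedAddCommGroup E] [NormedSpace 𝕜 E]

/-- The limits of vectors `s j` whose images `(A ^ j) (s j)` grow more slowly than `lam ^ j`: the
counterpart of `subspaceE` with the growth measured by `o(lam ^ j)`. -/
def slowForward (A : E →L[𝕜] E) (lam : ℝ) : Submodule 𝕜 E where
  carrier := {ξ | ∃ s : ℕ → E, Tendsto s atTop (𝓝 ξ) ∧
    (fun j => (A ^ j) (s j)) =o[atTop] fun j => lam ^ j}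
  add_mem' := by
    rintro ξ ζ ⟨s, hs, hs'⟩ ⟨t, ht, ht'⟩
    exact ⟨s + t, hs.add ht, (hs'.add ht').congr_left fun j => (map_add (A ^ j) _ _).symm⟩
  zero_mem' := ⟨0, tendsto_const_nhds,
    (isLittleO_zero _ _).congr_left fun j => (map_zero (A ^ j)).symm⟩
  smul_mem' := by
    rintro a ξ ⟨s, hs, hs'⟩
    exact ⟨a • s, hs.const_smul a,
      (hs'.const_smul_left a).congr_left fun j => (map_smul (A ^ j) _ _).symm⟩

/-- The limits of images `(A ^ j) (s j)` of vectors `s j` that grow more slowly than `lam ^ j`: the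
counterpart of `subspaceF` with the growth measured by `o(lam ^ j)`. -/
def slowBackward (A : E →L[𝕜] E) (lam : ℝ) : Submodule 𝕜 E where
  carrier := {ξ | ∃ s : ℕ → E, Tendsto (fun j => (A ^ j) (s j)) atTop (𝓝 ξ) ∧
    s =o[atTop] fun j => lam ^ j}
  add_mem' := by
    rintro ξ ζ ⟨s, hs, hs'⟩ ⟨t, ht, ht'⟩
    exact ⟨s + t, (hs.add ht).congr fun j => (map_add (A ^ j) _ _).symm, hs'.add ht'⟩
  zero_mem' := ⟨0, tendsto_const_nhds.congr fun j => (map_zero (A ^ j)).symm, isLittleO_zero _ _⟩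
  smul_mem' := by
    rintro a ξ ⟨s, hs, hs'⟩
    exact ⟨a • s, (hs.const_smul a).congr fun j => (map_smul (A ^ j) _ _).symm,
      hs'.const_smul_left a⟩

/-- The vectors with bounded forward orbit. -/
def boundedForward (A : E →L[𝕜] E) : Submodule 𝕜 E where
  carrier := {y | (fun j : ℕ => (A ^ j) y) =O[atTop] fun _ => (1 : ℝ)}
  add_mem' hy hz := (hy.add hz).congr_left fun j => (map_add (A ^ j) _ _).symm
  zero_mem' := (isBigO_zero _ _).congr_left fun j => (map_zero (A ^ j)).symm
  smul_mem' a _ hy := (hy.const_smul_left a).congr_left fun j => (map_smul (A ^ j) _ _).symm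

/-- The vectors with a bounded sequence of preimages under the powers of `A`. -/
def boundedBackward (A : E →L[𝕜] E) : Submodule 𝕜 E where
  carrier := {y | ∃ t : ℕ → E, (∀ j, (A ^ j) (t j) = y) ∧ t =O[atTop] fun _ => (1 : ℝ)}
  add_mem' := by
    rintro y z ⟨s, hs, hs'⟩ ⟨t, ht, ht'⟩
    exact ⟨s + t, fun j => by rw [Pi.add_apply, map_add, hs, ht], hs'.add ht'⟩
  zero_mem' := ⟨0, fun j => map_zero (A ^ j), isBigO_zero _ _⟩
  smul_mem' := by
    rintro a y ⟨t, ht, ht'⟩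
    exact ⟨a • t, fun j => by rw [Pi.smul_apply, map_smul, ht], ht'.const_smul_left a⟩

variable {A : E →L[𝕜] E} {lam : ℝ} {ξ : E}

theorem isClosed_isFlaring (A : E →L[𝕜] E) (lam : ℝ) :
    IsClosed {w : E | IsFlaring lam fun k => ‖(A ^ k) w‖} := by
  simp only [IsFlaring, Set.ofPred_forall]
  exact isClosed_iInter fun k => isClosed_le (by fun_prop) (by fun_prop)

theorem isFlaring_of_mem_closure {D U : Set E} (hU : IsOpen U)
    (hflare : ∀ c ∈ D, ∀ j, (A ^ j) c ∈ U → IsFlaring lam fun k => ‖(A ^ k) c‖) {w : E}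
    (hw : w ∈ closure D) {j : ℕ} (hj : (A ^ j) w ∈ U) : IsFlaring lam fun k => ‖(A ^ k) w‖ := by
  have hw' : w ∈ closure ((A ^ j) ⁻¹' U ∩ D) :=
    (hU.preimage (A ^ j).continuous).inter_closure ⟨hj, hw⟩
  exact closure_minimal (fun c hc => hflare c hc.2 j hc.1) (isClosed_isFlaring A lam) hw'

theorem mul_norm_map_le_of_isFlaring {s : ℕ → E} (hlam : 1 < lam) (hs : Tendsto s atTop (𝓝 ξ))
    (hgrowth : (fun j => (A ^ j) (s j)) =o[atTop] fun j => lam ^ j)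
    (hflare : ∀ᶠ j in atTop, IsFlaring lam fun k => ‖(A ^ k) (s j)‖) :
    lam * ‖A ξ‖ ≤ ‖ξ‖ := by
  by_contra! hexp
  have hAs : Tendsto (fun j => ‖A (s j)‖) atTop (𝓝 ‖A ξ‖) := ((A.continuous.tendsto ξ).comp hs).norm
  have hbound : ∀ᶠ j in atTop, ‖A (s j)‖ ≤ lam * (‖(A ^ j) (s j)‖ / lam ^ j) := by
    filter_upwards [hflare, hs.norm.eventually_lt (hAs.const_mul lam) hexp,
      eventually_ge_atTop 1] with j hj hlt hj1
    obtain ⟨k, rfl⟩ := Nat.exists_eq_add_of_le' hj1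
    have hgrow := hj.pow_mul_le_of_lt hlam (fun _ => norm_nonneg _) (by simpa using hlt) k
    rw [pow_one] at hgrow
    rw [mul_div_assoc', le_div_iff₀ (by positivity)]
    calc ‖A (s (k + 1))‖ * lam ^ (k + 1) = lam * (lam ^ k * ‖A (s (k + 1))‖) := by ring
      _ ≤ lam * ‖(A ^ (k + 1)) (s (k + 1))‖ := by gcongr
  have hAξ : ‖A ξ‖ ≤ 0 := by
    simpa using le_of_tendsto_of_tendsto hAs
      (hgrowth.norm_left.tendsto_div_nhds_zero.const_mul lam) hbound
  nlinarith [norm_nonneg ξ]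

theorem mul_norm_le_norm_map_of_isFlaring {s : ℕ → E} (hlam : 1 < lam)
    (hs : Tendsto (fun j => (A ^ j) (s j)) atTop (𝓝 ξ)) (hgrowth : s =o[atTop] fun j => lam ^ j)
    (hflare : ∀ᶠ j in atTop, IsFlaring lam fun k => ‖(A ^ k) (s j)‖) :
    lam * ‖ξ‖ ≤ ‖A ξ‖ := by
  by_contra! hcontr
  have hAs : Tendsto (fun j => ‖(A ^ (j + 1)) (s j)‖) atTop (𝓝 ‖A ξ‖) := by
    simpa only [pow_succ', mul_apply_eq_comp, Function.comp_apply] using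
      ((A.continuous.tendsto ξ).comp hs).norm
  have hbound : ∀ᶠ j in atTop, ‖(A ^ j) (s j)‖ ≤ ‖s j‖ / lam ^ j := by
    filter_upwards [hflare, hAs.eventually_lt (hs.norm.const_mul lam) hcontr] with j hj hlt
    rw [le_div_iff₀' (by positivity)]
    simpa using hj.pow_mul_le_zero hlam (fun _ => norm_nonneg _) j hlt
  have hξ : ‖ξ‖ ≤ 0 :=
    le_of_tendsto_of_tendsto hs.norm hgrowth.norm_left.tendsto_div_nhds_zero hbound
  nlinarith [norm_nonneg (A ξ)]

end SlowVectors

section HaagerupSchultz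

variable {E : Type*} [NormedAddCommGroup E] [InnerProductSpace ℂ E] {A : E →L[ℂ] E} {ν lam : ℝ}

theorem closure_boundedForward_subset (hν : 1 ≤ ν) :
    closure (boundedForward A : Set E) ⊆ subspaceE A ν := by
  intro ξ hξ
  obtain ⟨s, hs, ht⟩ := exists_seq_mem_tendsto_of_mem_closure
    (S := fun j : ℕ => {y | ‖(A ^ j) y‖ ≤ j}) (fun j => ⟨0, by simp⟩) (closure_mono (fun y hy => by
      obtain ⟨C, hC⟩ := hy.bound
      filter_upwards [hC, tendsto_natCast_atTop_atTop.eventually_ge_atTop C] with j hj hCj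
      exact (by simpa using hj : ‖(A ^ j) y‖ ≤ C).trans hCj) hξ)
  exact ⟨s, ht, (limsup_enorm_rpow_le_one (.of_forall hs)).trans (ENNReal.one_le_ofReal.2 hν)⟩

theorem closure_boundedBackward_subset (hν : 1 ≤ ν) :
    closure (boundedBackward A : Set E) ⊆ subspaceF A ν⁻¹ := by
  intro ξ hξ
  obtain ⟨s, hs, ht⟩ := exists_seq_mem_tendsto_of_mem_closure
    (S := fun j : ℕ => {y | ∃ t, (A ^ j) t = y ∧ ‖t‖ ≤ j}) (fun j => ⟨0, 0, by simp⟩)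
    (closure_mono (fun y hy => by
      obtain ⟨t, ht, ht'⟩ := hy
      obtain ⟨C, hC⟩ := ht'.bound
      filter_upwards [hC, tendsto_natCast_atTop_atTop.eventually_ge_atTop C] with j hj hCj
      exact ⟨t j, ht j, (by simpa using hj : ‖t j‖ ≤ C).trans hCj⟩) hξ)
  choose t hts htj using hs
  refine ⟨t, by simpa only [hts] using ht, ?_⟩
  rw [inv_inv]
  exact (limsup_enorm_rpow_le_one (.of_forall htj)).trans (ENNReal.one_le_ofReal.2 hν)

theorem subspaceE_subset_slowForward (hlam : 0 < lam) (hν : ν < lam) :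
    subspaceE A ν ⊆ slowForward A lam := by
  rintro ξ ⟨s, hs, hgrowth⟩
  exact ⟨s, hs, isLittleO_pow_of_limsup_le hlam hν hgrowth⟩

theorem subspaceF_subset_slowBackward (hlam : 0 < lam) (hν : ν < lam) :
    subspaceF A ν⁻¹ ⊆ slowBackward A lam := by
  rintro ξ ⟨s, hs, hgrowth⟩
  rw [inv_inv] at hgrowth
  exact ⟨s, hs, isLittleO_pow_of_limsup_le hlam hν hgrowth⟩

end HaagerupSchultz

open ComplexStarModule

section RealOperators

variable {E : Type*} [NormedAddCommGroup E] [NormedSpace ℂ E] [StarAddMonoid E]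
  {A : E →L[ℂ] E} {lam : ℝ} {ξ η : E}

theorem isSelfAdjoint_pow_map (hA : ∀ y, IsSelfAdjoint y → IsSelfAdjoint (A y)) (j : ℕ) {y : E}
    (hy : IsSelfAdjoint y) : IsSelfAdjoint ((A ^ j) y) := by
  induction j with
  | zero => exact hy
  | succ j ih => rw [pow_succ', mul_apply_eq_comp]; exact hA _ ih

variable [StarModule ℂ E]

theorem realPart_map (hA : ∀ y, IsSelfAdjoint y → IsSelfAdjoint (A y)) (y : E) :
    (ℜ (A y) : E) = A (ℜ y) := by
  conv_lhs => rw [← realPart_add_I_smul_imaginaryPart y]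
  simp [realPart_I_smul, (hA _ (ℜ y).2).coe_realPart, (hA _ (ℑ y).2).imaginaryPart]

theorem realPart_pow_map (hA : ∀ y, IsSelfAdjoint y → IsSelfAdjoint (A y)) (j : ℕ) (y : E) :
    (ℜ ((A ^ j) y) : E) = (A ^ j) (ℜ y) :=
  realPart_map (fun _ => isSelfAdjoint_pow_map hA j) y

variable [NormedStarGroup E]

theorem continuous_coe_realPart : Continuous fun y : E => (ℜ y : E) := by
  simp only [realPart_apply_coe]
  fun_prop

theorem exists_selfAdjoint_seq_of_mem_slowForward
    (hA : ∀ y, IsSelfAdjoint y → IsSelfAdjoint (A y)) (hξ : ξ ∈ slowForward A lam) :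
    ∃ s : ℕ → selfAdjoint E, Tendsto (fun j => (s j : E)) atTop (𝓝 (ℜ ξ)) ∧
      (fun j => (A ^ j) (s j)) =o[atTop] fun j => lam ^ j := by
  obtain ⟨s, hs, hgrowth⟩ := hξ
  refine ⟨fun j => ℜ (s j), (continuous_coe_realPart.tendsto ξ).comp hs,
    (IsBigO.of_bound' (.of_forall fun j => ?_)).trans_isLittleO hgrowth⟩
  rw [← realPart_pow_map hA]
  exact realPart.norm_le ((A ^ j) (s j))

theorem exists_selfAdjoint_seq_of_mem_slowBackward
    (hA : ∀ y, IsSelfAdjoint y → IsSelfAdjoint (A y)) (hξ : ξ ∈ slowBackward A lam) :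
    ∃ s : ℕ → selfAdjoint E, Tendsto (fun j => (A ^ j) (s j)) atTop (𝓝 (ℜ ξ)) ∧
      (fun j => (s j : E)) =o[atTop] fun j => lam ^ j := by
  obtain ⟨s, hs, hgrowth⟩ := hξ
  exact ⟨fun j => ℜ (s j),
    ((continuous_coe_realPart.tendsto ξ).comp hs).congr fun j => realPart_pow_map hA j (s j),
    (IsBigO.of_bound' (.of_forall fun j => realPart.norm_le (s j)) :
      (fun j => (ℜ (s j) : E)) =O[atTop] s).trans_isLittleO hgrowth⟩

theorem realPart_mem_slow (hA : ∀ y, IsSelfAdjoint y → IsSelfAdjoint (A y))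
    (hξ : ξ ∈ slowForward A lam ⊓ slowBackward A lam) :
    (ℜ ξ : E) ∈ slowForward A lam ⊓ slowBackward A lam := by
  obtain ⟨s, hs⟩ := exists_selfAdjoint_seq_of_mem_slowForward hA hξ.1
  obtain ⟨t, ht⟩ := exists_selfAdjoint_seq_of_mem_slowBackward hA hξ.2
  exact ⟨⟨fun j => s j, hs⟩, ⟨fun j => t j, ht⟩⟩

theorem imaginaryPart_mem_slow (hA : ∀ y, IsSelfAdjoint y → IsSelfAdjoint (A y))
    (hξ : ξ ∈ slowForward A lam ⊓ slowBackward A lam) :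
    (ℑ ξ : E) ∈ slowForward A lam ⊓ slowBackward A lam := by
  simpa [realPart_I_smul] using
    realPart_mem_slow hA ((slowForward A lam ⊓ slowBackward A lam).smul_mem Complex.I hξ)

/-- The flare inequality is available only along the orbits of vectors in `D`, which is dense in the
self-adjoint vectors alone; hence the passage to self-adjoint approximating sequences. -/
theorem eq_zero_of_mem_slow {D : Set E} (hlam : 1 < lam)
    (hA : ∀ y, IsSelfAdjoint y → IsSelfAdjoint (A y)) (hD : ∀ y, IsSelfAdjoint y → y ∈ closure D)
    (hη : IsSelfAdjoint η) (hslow : η ∈ slowForward A lam ⊓ slowBackward A lam)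
    (hflare : ∀ᶠ y in 𝓝 η, ∀ c ∈ D, ∀ j, (A ^ j) c = y → IsFlaring lam fun k => ‖(A ^ k) c‖) :
    η = 0 := by
  obtain ⟨U, hU, hUopen, hηU⟩ := eventually_nhds_iff.1 hflare
  have hflareU (w : selfAdjoint E) (j : ℕ) (hj : (A ^ j) w ∈ U) :
      IsFlaring lam fun k => ‖(A ^ k) (w : E)‖ :=
    isFlaring_of_mem_closure hUopen (fun c hc j hj => hU _ hj c hc j rfl) (hD w w.2) hj
  have hUη : U ∈ 𝓝 η := hUopen.mem_nhds hηU
  obtain ⟨s, hs, hs'⟩ := exists_selfAdjoint_seq_of_mem_slowForward hA hslow.1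
  obtain ⟨t, ht, ht'⟩ := exists_selfAdjoint_seq_of_mem_slowBackward hA hslow.2
  rw [hη.coe_realPart] at hs ht
  have hcontract : lam * ‖A η‖ ≤ ‖η‖ := mul_norm_map_le_of_isFlaring hlam hs hs' <|
    (hs.eventually_mem hUη).mono fun j hj => hflareU (s j) 0 hj
  have hexpand : lam * ‖η‖ ≤ ‖A η‖ := mul_norm_le_norm_map_of_isFlaring hlam ht ht' <|
    (ht.eventually_mem hUη).mono fun j hj => hflareU (t j) j hj
  refine norm_le_zero_iff.1 ?_
  nlinarith [norm_nonneg η, norm_nonneg (A η)]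

end RealOperators

theorem eventually_lt_re_inner_of_mem_closure {E : Type*} [NormedAddCommGroup E]
    [InnerProductSpace ℂ E] {S : Set E} {η : E} {θ : ℝ} (hθ : θ < 1) (hη : η ≠ 0)
    (hS : η ∈ closure S) :
    ∀ᶠ y in 𝓝 η, ∃ c ∈ S, θ * ‖c‖ * ‖y‖ < (inner ℂ c y).re := by
  have hangle : θ * ‖η‖ * ‖η‖ < (inner ℂ η η).re := by
    have hinner : (inner ℂ η η).re = ‖η‖ ^ 2 := inner_self_eq_norm_sq (𝕜 := ℂ) η
    nlinarith [pow_pos (norm_pos_iff.2 hη) 2]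
  have hopen : IsOpen {p : E × E | θ * ‖p.1‖ * ‖p.2‖ < (inner ℂ p.1 p.2).re} :=
    isOpen_lt (by fun_prop) (Complex.continuous_re.comp (by fun_prop))
  have hnear : ∀ᶠ p in 𝓝 η ×ˢ 𝓝 η, θ * ‖p.1‖ * ‖p.2‖ < (inner ℂ p.1 p.2).re := by
    rw [← nhds_prod_eq]
    exact hopen.mem_nhds hangle
  obtain ⟨P, hP, Q, hQ, hPQ⟩ := eventually_prod_iff.1 hnear
  obtain ⟨c, hcS, hc⟩ := ((mem_closure_iff_frequently.1 hS).and_eventually hP).exists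
  exact hQ.mono fun y hy => ⟨c, hcS, hPQ hc hy⟩

/-! ### Square-summable families and equivariant operators -/

section PartialIsometry

variable {𝕜 E F κ : Type*} [RCLike 𝕜] [NormedAddCommGroup E] [InnerProductSpace 𝕜 E]
  [CompleteSpace E] [NormedAddCommGroup F] [InnerProductSpace 𝕜 F] [CompleteSpace F]

theorem exists_clm_map_orthonormal {v : κ → E} {w : κ → F} (hv : Orthonormal 𝕜 v)
    (hw : Orthonormal 𝕜 w) :
    ∃ B : E →L[𝕜] F, (∀ k, B (v k) = w k) ∧ ∀ y, (∀ k, inner 𝕜 (v k) y = 0) → B y = 0 := by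
  classical
  let S := hv.orthogonalFamily.linearIsometry
  let T := hw.orthogonalFamily.linearIsometry
  have hS (k : κ) : S (lp.single 2 k 1) = v k := by simp [S]
  have hT (k : κ) : T (lp.single 2 k 1) = w k := by simp [T]
  have hcoord (k : κ) (y : E) : (S.toContinuousLinearMap.adjoint y) k = inner 𝕜 (v k) y := by
    have := lp.inner_single_left (𝕜 := 𝕜) k (1 : 𝕜) (S.toContinuousLinearMap.adjoint y)
    rw [ContinuousLinearMap.adjoint_inner_right] at this
    simpa [hS] using this.symm
  refine ⟨T.toContinuousLinearMap ∘L S.toContinuousLinearMap.adjoint, fun k => ?_, fun y hy => ?_⟩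
  · have hSv : S.toContinuousLinearMap.adjoint (v k) = lp.single 2 k 1 := by
      ext l
      rw [hcoord, orthonormal_iff_ite.1 hv, lp.single_apply, Pi.single_apply]
    simp [hSv, hT]
  · have hSy : S.toContinuousLinearMap.adjoint y = 0 :=
      lp.ext (funext fun k => by simp [hcoord, hy])
    simp [hSy]

end PartialIsometry

section RationalVectors

variable {ι : Type*}

/-- The Hilbert space of complex square-summable families indexed by `ι`. -/
abbrev L2 (ι : Type*) := lp (fun _ : ι => ℂ) 2

/-- The finitely supported rational families, as square-summable complex families. -/
def ratToL2 : (ι →₀ ℚ) →ₗ[ℚ] L2 ι where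
  toFun c := ⟨fun i => ((c i : ℚ) : ℂ), memℓp_gen <| summable_of_hasFiniteSupport <|
    c.hasFiniteSupport.subset fun i hi => by contrapose! hi; simp [Function.notMem_support.1 hi]⟩
  map_add' c d := by ext i; exact Rat.cast_add (c i) (d i)
  map_smul' q c := by ext i; simp [Rat.smul_def]

@[simp]
theorem ratToL2_apply (c : ι →₀ ℚ) (i : ι) : ratToL2 c i = (c i : ℂ) := rfl

theorem ratToL2_single [DecidableEq ι] (i : ι) (q : ℚ) :
    ratToL2 (Finsupp.single i q) = lp.single 2 i (q : ℂ) := by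
  ext j
  rw [ratToL2_apply, lp.single_apply, Finsupp.single_apply, Pi.single_apply]
  split_ifs with h h' h' <;> simp_all

theorem ratToL2_single_eq_smul (i : ι) (q : ℚ) :
    ratToL2 (Finsupp.single i q) = (q : ℂ) • ratToL2 (Finsupp.single i (1 : ℚ)) := by
  rw [← mul_one q, ← Finsupp.smul_single', map_smul, mul_one, Rat.cast_smul_eq_qsmul]

theorem isSelfAdjoint_ratToL2 (c : ι →₀ ℚ) : IsSelfAdjoint (ratToL2 c) := by
  ext i
  simp

theorem inner_ratToL2 (c d : ι →₀ ℚ) :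
    inner ℂ (ratToL2 c) (ratToL2 d) = ((∑ i ∈ c.support, (c i : ℝ) * (d i : ℝ) : ℝ) : ℂ) := by
  rw [lp.inner_eq_tsum, tsum_eq_sum (s := c.support)]
  · simp [mul_comm]
  · intro i hi
    simp [Finsupp.notMem_support_iff.1 hi]

theorem orthonormal_ratToL2_single :
    Orthonormal ℂ fun i : ι => ratToL2 (Finsupp.single i (1 : ℚ)) := by
  classical
  rw [orthonormal_iff_ite]
  intro i j
  simp [ratToL2_single, lp.inner_single_left, Pi.single_apply]

theorem clm_ext_ratToL2 {F : Type*} [AddCommMonoid F] [Module ℂ F] [TopologicalSpace F] [T2Space F]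
    {A B : L2 ι →L[ℂ] F} (h : ∀ c : ι →₀ ℚ, A (ratToL2 c) = B (ratToL2 c)) : A = B := by
  classical
  refine lp.ext_continuousLinearMap (by simp) fun i => ?_
  ext
  simpa [ratToL2_single] using h (Finsupp.single i 1)

theorem mem_closure_range_ratToL2 {y : L2 ι} (hy : IsSelfAdjoint y) :
    y ∈ closure (Set.range (ratToL2 (ι := ι))) := by
  classical
  have hreal (i : ι) : ((y i).re : ℂ) = y i :=
    Complex.conj_eq_iff_re.1 (congrArg (fun z : L2 ι => z i) hy)
  have hsingle (i : ι) : lp.single 2 i (y i) ∈ closure (Set.range (ratToL2 (ι := ι))) := by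
    have hcont : Continuous fun r : ℝ => (lp.single 2 i (r : ℂ) : L2 ι) :=
      (lp.singleContinuousLinearMap ℂ (fun _ : ι => ℂ) 2 i).continuous.comp
        Complex.continuous_ofReal
    rw [← hreal]
    refine map_mem_closure (f := fun r : ℝ => (lp.single 2 i (r : ℂ) : L2 ι)) hcont
      (Rat.isDenseEmbedding_coe_real.dense _) ?_
    rintro _ ⟨q, rfl⟩
    exact ⟨Finsupp.single i q, by simp [ratToL2_single]⟩
  let K : AddSubgroup (L2 ι) := (ratToL2 (ι := ι)).toAddMonoidHom.range
  have hsum : HasSum (fun i => lp.single 2 i (y i)) y := lp.hasSum_single (by simp) y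
  exact K.isClosed_topologicalClosure.mem_of_tendsto hsum
    (.of_forall fun s => K.topologicalClosure.sum_mem fun i _ => hsingle i)

theorem isSelfAdjoint_map_of_map_ratToL2 {ι' : Type*} {A : L2 ι →L[ℂ] L2 ι'}
    {L : (ι →₀ ℚ) → (ι' →₀ ℚ)} (hA : ∀ c, A (ratToL2 c) = ratToL2 (L c)) {y : L2 ι}
    (hy : IsSelfAdjoint y) : IsSelfAdjoint (A y) := by
  have hclosed : IsClosed {z : L2 ι' | IsSelfAdjoint z} := isClosed_eq continuous_star continuous_id
  refine hclosed.closure_subset (map_mem_closure A.continuous (mem_closure_range_ratToL2 hy) ?_)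
  rintro _ ⟨c, rfl⟩
  exact hA c ▸ isSelfAdjoint_ratToL2 (L c)

end RationalVectors

section Equivariant

variable {G ι : Type*} [Group G] [MulAction G ι]

/-- The action of a group on the finitely supported families indexed by a set on which it acts,
`i ↦ g • i` on indices. -/
def translate (g : G) : (ι →₀ ℚ) →ₗ[ℚ] (ι →₀ ℚ) := Finsupp.lmapDomain ℚ ℚ (g • ·)

@[simp]
theorem translate_single (g : G) (i : ι) (q : ℚ) :
    translate g (Finsupp.single i q) = Finsupp.single (g • i) q :=
  Finsupp.mapDomain_single

theorem norm_ratToL2_translate (g : G) (c : ι →₀ ℚ) : ‖ratToL2 (translate g c)‖ = ‖ratToL2 c‖ := by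
  classical
  have hg : Function.Injective (g • · : ι → ι) := MulAction.injective g
  rw [norm_eq_sqrt_re_inner (𝕜 := ℂ), norm_eq_sqrt_re_inner (𝕜 := ℂ), inner_ratToL2, inner_ratToL2,
    translate, Finsupp.lmapDomain_apply, Finsupp.mapDomain_support_of_injective hg,
    Finset.sum_image fun _ _ _ _ h => hg h]
  simp only [Finsupp.mapDomain_apply hg]

@[simp]
theorem translate_one (c : ι →₀ ℚ) : translate (1 : G) c = c :=
  (congrArg (Finsupp.mapDomain · c) (funext (one_smul G))).trans Finsupp.mapDomain_id

theorem translate_mul (g h : G) (c : ι →₀ ℚ) :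
    translate (g * h) c = translate g (translate h c) := by
  induction c using Finsupp.induction_linear with
  | zero => simp
  | add c d hc hd => simp only [map_add, hc, hd]
  | single i q => simp [mul_smul]

theorem surjective_smul_out :
    Function.Surjective fun p : G × MulAction.orbitRel.Quotient G ι => p.1 • p.2.out := by
  intro i
  obtain ⟨g, hg⟩ := (MulAction.orbitRel G ι).symm (Quotient.mk_out (s := MulAction.orbitRel G ι) i)
  exact ⟨(g, Quotient.mk _ i), hg⟩

theorem bijective_smul_out [IsCancelSMul G ι] :
    Function.Bijective fun p : G × MulAction.orbitRel.Quotient G ι => p.1 • p.2.out := by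
  refine ⟨?_, surjective_smul_out⟩
  rintro ⟨g, t⟩ ⟨h, t'⟩ (hgh : g • t.out = h • t'.out)
  obtain rfl : t = t' := by
    rw [← Quotient.out_eq t, ← Quotient.out_eq t', ← MulAction.orbitRel.Quotient.quotient_smul_eq,
      hgh, MulAction.orbitRel.Quotient.quotient_smul_eq]
  rw [IsCancelSMul.right_cancel g h _ hgh]

theorem eq_top_of_single_out_mem {W : Submodule ℚ (ι →₀ ℚ)}
    (hW : ∀ g : G, ∀ c ∈ W, translate g c ∈ W)
    (hout : ∀ t : MulAction.orbitRel.Quotient G ι, Finsupp.single t.out 1 ∈ W) : W = ⊤ := by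
  rw [eq_top_iff, ← Finsupp.basisSingleOne.span_eq, Submodule.span_le]
  rintro _ ⟨i, rfl⟩
  obtain ⟨⟨g, t⟩, rfl⟩ := surjective_smul_out (G := G) i
  simpa using hW g _ (hout t)

theorem exists_equivariant_apply_single_out [IsCancelSMul G ι]
    (s : MulAction.orbitRel.Quotient G ι → ι →₀ ℚ) :
    ∃ L : (ι →₀ ℚ) →ₗ[ℚ] (ι →₀ ℚ), (∀ (g : G) c, L (translate g c) = translate g (L c)) ∧
      ∀ t, L (Finsupp.single t.out 1) = s t := by
  let e := Equiv.ofBijective _ (bijective_smul_out (G := G) (ι := ι))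
  let L : (ι →₀ ℚ) →ₗ[ℚ] (ι →₀ ℚ) :=
    Finsupp.linearCombination ℚ fun i => translate (e.symm i).1 (s (e.symm i).2)
  have hL (g : G) (t : MulAction.orbitRel.Quotient G ι) :
      L (Finsupp.single (g • t.out) 1) = translate g (s t) := by
    have ht : e.symm (g • t.out) = (g, t) := e.symm_apply_apply (g, t)
    simp [L, ht]
  refine ⟨L, fun g c => ?_, fun t => ?_⟩
  · suffices h : L ∘ₗ translate g = translate g ∘ₗ L from LinearMap.congr_fun h c
    ext1 i
    ext1
    obtain ⟨⟨h, t⟩, rfl⟩ := surjective_smul_out (G := G) i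
    simp [smul_smul, hL, translate_mul]
  · simpa using hL 1 t

theorem exists_equivariant_mem_sub_mem [IsCancelSMul G ι] {W W' : Submodule ℚ (ι →₀ ℚ)}
    (hW : ∀ g : G, ∀ c ∈ W, translate g c ∈ W) (hW' : ∀ g : G, ∀ c ∈ W', translate g c ∈ W')
    (hsup : W ⊔ W' = ⊤) :
    ∃ L : (ι →₀ ℚ) →ₗ[ℚ] (ι →₀ ℚ), (∀ (g : G) c, L (translate g c) = translate g (L c)) ∧
      ∀ c, L c ∈ W ∧ c - L c ∈ W' := by
  have hdecomp (t : MulAction.orbitRel.Quotient G ι) :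
      ∃ c ∈ W, Finsupp.single t.out 1 - c ∈ W' := by
    obtain ⟨c, hc, d, hd, hcd⟩ :=
      Submodule.mem_sup.1 (hsup ▸ Submodule.mem_top : Finsupp.single t.out 1 ∈ W ⊔ W')
    exact ⟨c, hc, by rwa [← hcd, add_sub_cancel_left]⟩
  choose s hs hs' using hdecomp
  obtain ⟨L, hL, hLs⟩ := exists_equivariant_apply_single_out (G := G) s
  have hmem : W.comap L ⊓ W'.comap (LinearMap.id - L) = ⊤ := by
    refine eq_top_of_single_out_mem (G := G) (fun g c hc => ⟨?_, ?_⟩) fun t => ⟨?_, ?_⟩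
    · simpa [hL] using hW g _ hc.1
    · simpa [hL] using hW' g _ hc.2
    · simpa [hLs] using hs t
    · simpa [hLs] using hs' t
  exact ⟨L, hL, fun c => (hmem ▸ Submodule.mem_top : c ∈ W.comap L ⊓ W'.comap (LinearMap.id - L))⟩

variable [IsCancelSMul G ι] {K κ : Type*} [Group K] [MulAction K κ] [IsCancelSMul K κ] {φ : G → K}

theorem exists_clm_map_orbit (hφ : Function.Injective φ) (i : ι) (d : κ →₀ ℚ) :
    ∃ B : L2 ι →L[ℂ] L2 κ,
      (∀ g : G, B (ratToL2 (Finsupp.single (g • i) 1)) = ratToL2 (translate (φ g) d)) ∧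
      ∀ j ∉ MulAction.orbit G i, B (ratToL2 (Finsupp.single j 1)) = 0 := by
  have hpiece (k : κ) : ∃ B : L2 ι →L[ℂ] L2 κ,
      (∀ g : G, B (ratToL2 (Finsupp.single (g • i) 1)) = ratToL2 (Finsupp.single (φ g • k) 1)) ∧
      ∀ j ∉ MulAction.orbit G i, B (ratToL2 (Finsupp.single j 1)) = 0 := by
    obtain ⟨B, hB, hB0⟩ := exists_clm_map_orthonormal
      (orthonormal_ratToL2_single.comp (fun g : G => g • i)
        fun g h => IsCancelSMul.right_cancel g h i)
      (orthonormal_ratToL2_single.comp (fun g : G => φ g • k)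
        fun g h hgh => hφ (IsCancelSMul.right_cancel _ _ k hgh))
    exact ⟨B, hB, fun j hj => hB0 _ fun g =>
      orthonormal_ratToL2_single.2 fun h => hj ⟨g, h⟩⟩
  choose B hB hB0 using hpiece
  refine ⟨d.sum fun k q => (q : ℂ) • B k, fun g => ?_, fun j hj => ?_⟩
  · rw [translate, Finsupp.lmapDomain_apply, Finsupp.mapDomain, map_finsuppSum]
    simp [Finsupp.sum, hB, ratToL2_single_eq_smul _ (d _)]
  · simp [Finsupp.sum, hB0 _ j hj]

theorem exists_clm_of_equivariant [Finite (MulAction.orbitRel.Quotient G ι)]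
    (hφ : Function.Injective φ) {L : (ι →₀ ℚ) →ₗ[ℚ] (κ →₀ ℚ)}
    (hL : ∀ g c, L (translate g c) = translate (φ g) (L c)) :
    ∃ A : L2 ι →L[ℂ] L2 κ, ∀ c, A (ratToL2 c) = ratToL2 (L c) := by
  have := Fintype.ofFinite (MulAction.orbitRel.Quotient G ι)
  choose B hB hB0 using fun t : MulAction.orbitRel.Quotient G ι =>
    exists_clm_map_orbit hφ t.out (L (Finsupp.single t.out 1))
  refine ⟨∑ t, B t, fun c => ?_⟩
  suffices h : ((∑ t, B t : L2 ι →L[ℂ] L2 κ) : L2 ι →ₗ[ℂ] L2 κ).restrictScalars ℚ ∘ₗ ratToL2 =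
      ratToL2 ∘ₗ L from LinearMap.congr_fun h c
  ext1 i
  ext1
  obtain ⟨⟨g, t⟩, rfl⟩ := surjective_smul_out (G := G) i
  have hothers (t' : MulAction.orbitRel.Quotient G ι) (ht : t' ≠ t) :
      B t' (ratToL2 (Finsupp.single (g • t.out) 1)) = 0 := by
    refine hB0 t' _ ?_
    rintro ⟨h, hh⟩
    exact ht (congrArg Prod.snd (bijective_smul_out.1 (a₁ := (h, t')) (a₂ := (g, t)) hh))
  have hLt : L (Finsupp.single (g • t.out) 1) = translate (φ g) (L (Finsupp.single t.out 1)) := by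
    rw [← hL, translate_single]
  simp [Fintype.sum_eq_single t hothers, hB, hLt]

end Equivariant

/-! ### Hyperbolic and quasi-fixed subspaces -/

section HyperbolicQuasiFixed

variable {ι : Type*}

/-- The closed complex subspace generated by a space of rational families: `l2Closure` for families
indexed by an arbitrary set. -/
def l2Span (W : Submodule ℚ (ι →₀ ℚ)) : Submodule ℂ (L2 ι) :=
  (Submodule.span ℂ (ratToL2 '' (W : Set (ι →₀ ℚ)))).topologicalClosure

/-- The rational families that make a small angle with some element of `W`: `angleNhd` for families
indexed by an arbitrary set. -/
def angleCone (θ : ℝ) (W : Submodule ℚ (ι →₀ ℚ)) : Set (ι →₀ ℚ) :=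
  {d | ∃ c ∈ W, θ * ‖ratToL2 c‖ * ‖ratToL2 d‖ < (inner ℂ (ratToL2 c) (ratToL2 d)).re}

theorem iterate_mem_orbitSet {M : Type*} {L : M → M} {N : Set M} {c : M} {j : ℕ}
    (hc : L^[j] c ∈ N) (k : ℕ) : L^[k] c ∈ orbitSet L N := by
  rw [orbitSet, Set.mem_iUnion]
  rcases le_total k j with h | h
  · refine ⟨j - k, .inr ?_⟩
    rwa [Set.mem_preimage, ← Function.iterate_add_apply, Nat.sub_add_cancel h]
  · exact ⟨k - j, .inl ⟨_, hc, by rw [← Function.iterate_add_apply, Nat.sub_add_cancel h]⟩⟩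

variable {W : Submodule ℚ (ι →₀ ℚ)} {L : (ι →₀ ℚ) →ₗ[ℚ] (ι →₀ ℚ)} {A : L2 ι →L[ℂ] L2 ι}

theorem pow_apply_ratToL2 (hA : ∀ c, A (ratToL2 c) = ratToL2 (L c)) (j : ℕ) (c : ι →₀ ℚ) :
    (A ^ j) (ratToL2 c) = ratToL2 (L^[j] c) := by
  induction j with
  | zero => rfl
  | succ j ih => rw [pow_succ', mul_apply_eq_comp, ih, hA, Function.iterate_succ_apply']

theorem eq_zero_of_mem_closure_hyperbolic {lam θ : ℝ} (hlam : 1 < lam) (hθ : θ < 1)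
    (hflare : ∀ c ∈ orbitSet L (angleCone θ W),
      lam * ‖ratToL2 (L c)‖ ≤ max ‖ratToL2 (L (L c))‖ ‖ratToL2 c‖)
    (hA : ∀ c, A (ratToL2 c) = ratToL2 (L c)) {η : L2 ι} (hη : IsSelfAdjoint η)
    (hηW : η ∈ closure (ratToL2 '' (W : Set (ι →₀ ℚ))))
    (hslow : η ∈ slowForward A lam ⊓ slowBackward A lam) : η = 0 := by
  by_contra hη0
  refine hη0 (eq_zero_of_mem_slow hlam (fun _ => isSelfAdjoint_map_of_map_ratToL2 hA)
    (fun _ => mem_closure_range_ratToL2) hη hslow ?_)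
  filter_upwards [eventually_lt_re_inner_of_mem_closure hθ hη0 hηW]
  rintro y hy _ ⟨c, rfl⟩ j rfl k
  simp only [pow_apply_ratToL2 hA, Function.iterate_succ_apply']
  refine hflare _ (iterate_mem_orbitSet (j := j) ?_ k)
  obtain ⟨_, ⟨d, hd, rfl⟩, hangle⟩ := hy
  exact ⟨d, hd, by rwa [← pow_apply_ratToL2 hA]⟩

variable {G : Type*} [Group G] [MulAction G ι]

theorem iterate_translate_of_map_eq_self {φ : G → G}
    (hL : ∀ g c, L (translate g c) = translate (φ g) (L c)) {ρ : ι →₀ ℚ} (hρ : L ρ = ρ) (j : ℕ)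
    (g : G) : L^[j] (translate g ρ) = translate (φ^[j] g) ρ := by
  induction j with
  | zero => rfl
  | succ j ih => rw [Function.iterate_succ_apply', ih, hL, hρ, Function.iterate_succ_apply']

theorem ratToL2_translate_mem_bounded {φ : G → G} (hφ : Function.Surjective φ)
    (hL : ∀ g c, L (translate g c) = translate (φ g) (L c))
    (hA : ∀ c, A (ratToL2 c) = ratToL2 (L c)) {ρ : ι →₀ ℚ} (hρ : L ρ = ρ) (g : G) :
    ratToL2 (translate g ρ) ∈ boundedForward A ⊓ boundedBackward A := by
  have hpow (j : ℕ) (g : G) :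
      (A ^ j) (ratToL2 (translate g ρ)) = ratToL2 (translate (φ^[j] g) ρ) := by
    rw [pow_apply_ratToL2 hA, iterate_translate_of_map_eq_self hL hρ]
  have hbounded (γ : ℕ → G) :
      (fun j => ratToL2 (translate (γ j) ρ)) =O[atTop] fun _ => (1 : ℝ) :=
    .of_bound ‖ratToL2 ρ‖ (.of_forall fun j => by simp [norm_ratToL2_translate])
  choose γ hγ using fun j => hφ.iterate j g
  exact ⟨(hbounded fun j => φ^[j] g).congr_left fun j => (hpow j g).symm,
    fun j => ratToL2 (translate (γ j) ρ), fun j => by rw [hpow, hγ], hbounded γ⟩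

theorem span_le_bounded {φ : G → G} (hφ : Function.Surjective φ)
    (hL : ∀ g c, L (translate g c) = translate (φ g) (L c))
    (hA : ∀ c, A (ratToL2 c) = ratToL2 (L c)) {ρ : ι →₀ ℚ} (hρ : L ρ = ρ)
    (hW : W ≤ Submodule.span ℚ (Set.range fun g : G => translate g ρ)) :
    Submodule.span ℂ (ratToL2 '' (W : Set (ι →₀ ℚ))) ≤ boundedForward A ⊓ boundedBackward A := by
  have htranslates : Submodule.span ℚ (Set.range fun g : G => translate g ρ) ≤
      ((boundedForward A ⊓ boundedBackward A).restrictScalars ℚ).comap ratToL2 :=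
    Submodule.span_le.2 <| Set.range_subset_iff.2 (ratToL2_translate_mem_bounded hφ hL hA hρ)
  exact Submodule.span_le.2 (Set.image_subset_iff.2 (hW.trans htranslates))

theorem l2Span_subset {φ : G → G} (hφ : Function.Surjective φ)
    (hL : ∀ g c, L (translate g c) = translate (φ g) (L c))
    (hA : ∀ c, A (ratToL2 c) = ratToL2 (L c)) {ρ : ι →₀ ℚ} (hρ : L ρ = ρ)
    (hW : W ≤ Submodule.span ℚ (Set.range fun g : G => translate g ρ)) {ν : ℝ} (hν : 1 ≤ ν) :
    (l2Span W : Set (L2 ι)) ⊆ subspaceE A ν ∩ subspaceF A ν⁻¹ := by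
  have hbounded := span_le_bounded hφ hL hA hρ hW
  exact Set.subset_inter
    ((closure_mono (hbounded.trans inf_le_left)).trans (closure_boundedForward_subset hν))
    ((closure_mono (hbounded.trans inf_le_right)).trans (closure_boundedBackward_subset hν))

variable [IsCancelSMul G ι] [Finite (MulAction.orbitRel.Quotient G ι)]

/-- Choosing the rational decomposition equivariantly makes it bounded, so that it extends to the
completion. -/
theorem exists_mem_closure_sub_mem_l2Span {W W' : Submodule ℚ (ι →₀ ℚ)}
    (hW : ∀ g : G, ∀ c ∈ W, translate g c ∈ W) (hW' : ∀ g : G, ∀ c ∈ W', translate g c ∈ W')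
    (hsup : W ⊔ W' = ⊤) {ζ : L2 ι} (hζ : IsSelfAdjoint ζ) :
    ∃ η ∈ closure (ratToL2 '' (W : Set (ι →₀ ℚ))), IsSelfAdjoint η ∧ ζ - η ∈ l2Span W' := by
  obtain ⟨L, hL, hLW⟩ := exists_equivariant_mem_sub_mem hW hW' hsup
  obtain ⟨P, hP⟩ := exists_clm_of_equivariant Function.injective_id hL
  have hζ' := mem_closure_range_ratToL2 hζ
  refine ⟨P ζ, map_mem_closure P.continuous hζ' ?_, isSelfAdjoint_map_of_map_ratToL2 hP hζ,
    map_mem_closure (f := fun z => z - P z) (by fun_prop) hζ' ?_⟩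
  · rintro _ ⟨c, rfl⟩
    exact ⟨L c, (hLW c).1, (hP c).symm⟩
  · rintro _ ⟨c, rfl⟩
    exact Submodule.subset_span ⟨c - L c, (hLW c).2, by simp only [map_sub, hP]⟩

theorem slow_le_l2Span {lam θ : ℝ} (hlam : 1 < lam) (hθ : θ < 1) {W W' : Submodule ℚ (ι →₀ ℚ)}
    (hflare : ∀ c ∈ orbitSet L (angleCone θ W),
      lam * ‖ratToL2 (L c)‖ ≤ max ‖ratToL2 (L (L c))‖ ‖ratToL2 c‖)
    (hA : ∀ c, A (ratToL2 c) = ratToL2 (L c))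
    (hW : ∀ g : G, ∀ c ∈ W, translate g c ∈ W) (hW' : ∀ g : G, ∀ c ∈ W', translate g c ∈ W')
    (hsup : W ⊔ W' = ⊤) (hslow : l2Span W' ≤ slowForward A lam ⊓ slowBackward A lam) :
    slowForward A lam ⊓ slowBackward A lam ≤ l2Span W' := by
  have hreal (ζ : L2 ι) (hζ : IsSelfAdjoint ζ)
      (hζslow : ζ ∈ slowForward A lam ⊓ slowBackward A lam) : ζ ∈ l2Span W' := by
    obtain ⟨η, hηW, hη, hζη⟩ := exists_mem_closure_sub_mem_l2Span hW hW' hsup hζ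
    have hηslow : η ∈ slowForward A lam ⊓ slowBackward A lam := by
      simpa using sub_mem hζslow (hslow hζη)
    rwa [eq_zero_of_mem_closure_hyperbolic hlam hθ hflare hA hη hηW hηslow, sub_zero] at hζη
  intro ξ hξ
  have hAreal := fun y => isSelfAdjoint_map_of_map_ratToL2 hA (y := y)
  rw [← realPart_add_I_smul_imaginaryPart ξ]
  exact add_mem (hreal _ (ℜ ξ).2 (realPart_mem_slow hAreal hξ))
    (Submodule.smul_mem _ _ (hreal _ (ℑ ξ).2 (imaginaryPart_mem_slow hAreal hξ)))

end HyperbolicQuasiFixed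

/-! ### Lifting to the universal cover -/

section FundamentalGroupoid

variable {V : Type u} [Quiver.{v} V]

theorem GraphMap.mapClass_comp (f : GraphMap V) {a b c : V} (p : PathClass a b)
    (q : PathClass b c) : f.mapClass (p ≫ q) = f.mapClass p ≫ f.mapClass q :=
  f.induced.map_comp p q

theorem GraphMap.mapClass_edgeClass (f : GraphMap V) {a b : V} (e : a ⟶ b) :
    f.mapClass (edgeClass e) = pathClass (f.map e) :=
  Category.id_comp (pathClass (f.map e))

theorem GraphMap.IsHomotopyEquiv.isEquivalence {f : GraphMap V} (hf : f.IsHomotopyEquiv) :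
    f.induced.IsEquivalence := by
  obtain ⟨g, ⟨i⟩, ⟨j⟩⟩ := hf
  exact (CategoryTheory.Equivalence.mk f.induced g.induced i.symm j).isEquivalence_functor

end FundamentalGroupoid

section UniversalCoverTree

variable {V : Type u} [Quiver.{v} V] {x : V}

/-- Along an edge `e : a ⟶ b`, turns a function recording a chain for each vertex of the universal
cover above `a` into one for the vertices above `b`, by adding the lift of `e` that ends there. -/
def edgeTransport (x : V) {a b : V} (e : a ⟶ b) :
    (PathClass x a → Chain1 x) ≃ (PathClass x b → Chain1 x) where
  toFun F q := F (q ≫ Groupoid.inv (edgeClass e)) +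
    Finsupp.single ⟨a, b, e, q ≫ Groupoid.inv (edgeClass e)⟩ 1
  invFun F p := F (p ≫ edgeClass e) - Finsupp.single ⟨a, b, e, p⟩ 1
  left_inv F := by simp
  right_inv F := by simp

theorem edgeTransport_comp_edgeClass {a b : V} (e : a ⟶ b) (F : PathClass x a → Chain1 x)
    (p : PathClass x a) :
    edgeTransport x e F (p ≫ edgeClass e) = F p + Finsupp.single ⟨a, b, e, p⟩ 1 := by
  simp [edgeTransport]

/-- The action of path classes obtained from `edgeTransport` by the universal property of the
fundamental groupoid. -/
def transport (x : V) : Pi1 V ⥤ Core (Type (max u v)) :=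
  Quiver.FreeGroupoid.lift
    { obj := fun a => ⟨PathClass x a → Chain1 x⟩
      map := fun e => ⟨(edgeTransport x e).toIso⟩ }

/-- The chain of the path in the universal cover from the base point to a vertex. -/
def liftedChain (w : CoverVertex x) : Chain1 x :=
  ((transport x).map w.path).iso.hom (fun _ : PathClass x x => (0 : Chain1 x)) w.path

theorem liftedChain_terminal (e : CoverEdge x) :
    liftedChain e.terminal = liftedChain e.initial + Finsupp.single e 1 := by
  have hcomp : (transport x).map (e.path ≫ edgeClass e.edge) =
      (transport x).map e.path ≫ ⟨(edgeTransport x e.edge).toIso⟩ :=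
    (transport x).map_comp e.path (edgeClass e.edge)
  have hterminal : liftedChain e.terminal = edgeTransport x e.edge
      (((transport x).map e.path).iso.hom fun _ : PathClass x x => (0 : Chain1 x))
      (e.path ≫ edgeClass e.edge) := by
    unfold liftedChain CoverEdge.terminal
    simp only
    rw [hcomp]
    rfl
  exact hterminal.trans (edgeTransport_comp_edgeClass e.edge _ e.path)

@[simp]
theorem boundary_single (e : CoverEdge x) (q : ℚ) :
    boundary (Finsupp.single e q) = Finsupp.single e.terminal q - Finsupp.single e.initial q := by
  simp [boundary, smul_sub]

/-- A cycle vanishes because a chain `c` is recovered from its boundary by replacing each vertex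
with the chain of the path from the base point to it. -/
theorem boundary_injective : Function.Injective (boundary (x := x)) := by
  have hleft : Finsupp.linearCombination ℚ (liftedChain (x := x)) ∘ₗ boundary = LinearMap.id := by
    ext1 e
    ext1
    simp [liftedChain_terminal]
  exact Function.LeftInverse.injective (g := Finsupp.linearCombination ℚ liftedChain)
    fun c => LinearMap.congr_fun hleft c

end UniversalCoverTree

section Lift

variable {V : Type u} [Quiver.{v} V] {x : V} (f : GraphMap V) (hx : f.obj x = x)

/-- The endomorphism of the fundamental group induced by `f`. -/
def groupMap (g : PathClass x x) : PathClass x x :=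
  liftPath f hx g ≫ eqToHom (congrArg (fun a : V => pt a) hx)

theorem groupMap_bijective (hf : f.IsHomotopyEquiv) : Function.Bijective (groupMap f hx) := by
  have := hf.isEquivalence
  refine ⟨fun g h hgh => ?_, fun g => ?_⟩
  · unfold groupMap liftPath at hgh
    rw [cancel_mono, cancel_epi] at hgh
    exact f.induced.map_injective hgh
  · obtain ⟨h, hh⟩ : ∃ h : PathClass x x, f.mapClass h =
        eqToHom (congrArg (fun a : V => pt a) hx) ≫ g ≫
          eqToHom (congrArg (fun a : V => pt a) hx.symm) := f.induced.map_surjective _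
    refine ⟨h, ?_⟩
    rw [groupMap, liftPath, hh]
    simp

theorem liftPath_comp {a b : V} (p : PathClass x a) (q : PathClass a b) :
    liftPath f hx (p ≫ q) = liftPath f hx p ≫ f.mapClass q := by
  rw [liftPath, GraphMap.mapClass_comp, ← Category.assoc]
  rfl

theorem liftPath_group_comp {a : V} (g : PathClass x x) (p : PathClass x a) :
    liftPath f hx (g ≫ p) = groupMap f hx g ≫ liftPath f hx p := by
  rw [liftPath_comp, groupMap, liftPath.eq_def f hx p]
  simp

theorem boundary_pathChain {a b : V} (s : PathClass x a) (p : EdgePath a b) :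
    boundary (pathChain s p) =
      Finsupp.single ⟨b, s ≫ pathClass p⟩ 1 - Finsupp.single ⟨a, s⟩ 1 := by
  induction p with
  | nil => simp [pathChain, pathClass]
  | forward p e ih =>
    rw [pathChain, map_add, ih]
    simp [CoverEdge.terminal, CoverEdge.initial, pathClass]
  | backward p e ih =>
    rw [pathChain, map_sub, ih]
    simp [CoverEdge.terminal, CoverEdge.initial, pathClass]

theorem boundary_chainMap (c : Chain1 x) :
    boundary (chainMap f hx c) = Finsupp.lmapDomain ℚ ℚ (liftVertex f hx) (boundary c) := by
  suffices h : boundary ∘ₗ chainMap f hx = Finsupp.lmapDomain ℚ ℚ (liftVertex f hx) ∘ₗ boundary from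
    LinearMap.congr_fun h c
  ext1 e
  ext1
  simp [chainMap, boundary_pathChain, liftVertex, CoverEdge.terminal,
    CoverEdge.initial, liftPath_comp, GraphMap.mapClass_edgeClass, Finsupp.mapDomain_sub]

theorem chainMap_eq_self {w w' : CoverVertex x} {c : Chain1 x} (hw : liftVertex f hx w = w)
    (hw' : liftVertex f hx w' = w')
    (hc : boundary c = Finsupp.single w' 1 - Finsupp.single w 1) : chainMap f hx c = c := by
  apply boundary_injective
  rw [boundary_chainMap, hc, map_sub]
  simp [hw, hw']

theorem pathChain_comp {a b : V} (g : PathClass x x) (s : PathClass x a) (p : EdgePath a b) :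
    pathChain (g ≫ s) p = Finsupp.lmapDomain ℚ ℚ (CoverEdge.translate g) (pathChain s p) := by
  induction p with
  | nil => simp [pathChain]
  | forward p e ih => simp [pathChain, ih, Finsupp.mapDomain_add, CoverEdge.translate]
  | backward p e ih => simp [pathChain, ih, Finsupp.mapDomain_sub, CoverEdge.translate]

end Lift

section RelativeChains

variable {V : Type u} [Quiver.{v} V] {x : V} {H : Subgraph V}

/-- The fundamental group acts by deck transformations on the edges outside the preimage of `H`. -/
instance : MulAction (PathClass x x) (RelEdge H x) where
  smul := RelEdge.translate
  one_smul _ := Subtype.ext (CoverEdge.ext rfl rfl HEq.rfl (heq_of_eq (Category.id_comp _)))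
  mul_smul g h e :=
    Subtype.ext (CoverEdge.ext rfl rfl HEq.rfl (heq_of_eq (Category.assoc g h e.1.path)))

theorem RelEdge.translate_injective (e : RelEdge H x) :
    Function.Injective fun g : PathClass x x => RelEdge.translate g e := by
  intro g h hgh
  have hpath : g ≫ e.1.path = h ≫ e.1.path := by
    simpa [RelEdge.translate, CoverEdge.translate] using hgh
  exact (cancel_mono e.1.path).1 hpath

instance : IsCancelSMul (PathClass x x) (RelEdge H x) where
  left_cancel' g _ _ h := MulAction.injective g h
  right_cancel' _ _ _ h := RelEdge.translate_injective _ h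

instance [Finite V] [∀ a b : V, Finite (a ⟶ b)] :
    Finite (MulAction.orbitRel.Quotient (PathClass x x) (RelEdge H x)) := by
  refine Finite.of_injective
    (fun t => (⟨t.out.1.src, t.out.1.tgt, t.out.1.edge⟩ : Σ a b : V, (a ⟶ b))) fun s t hst => ?_
  suffices h : ∀ e e' : RelEdge H x,
      (⟨e.1.src, e.1.tgt, e.1.edge⟩ : Σ a b : V, (a ⟶ b)) = ⟨e'.1.src, e'.1.tgt, e'.1.edge⟩ →
      ∃ g : PathClass x x, g • e' = e by
    rw [← Quotient.out_eq s, ← Quotient.out_eq t]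
    exact Quotient.sound (h _ _ hst)
  rintro ⟨⟨a, b, e, p⟩, he⟩ ⟨⟨a', b', e', p'⟩, he'⟩ h
  obtain ⟨rfl, h⟩ := Sigma.mk.inj h
  obtain ⟨rfl, h⟩ := Sigma.mk.inj (eq_of_heq h)
  obtain rfl := eq_of_heq h
  exact ⟨p ≫ Groupoid.inv p', by simp [HSMul.hSMul, SMul.smul, RelEdge.translate,
    CoverEdge.translate]⟩

theorem relProj_single_of_notMem {e : CoverEdge x} (he : e.edge ∉ H.edges) (q : ℚ) :
    relProj H x (Finsupp.single e q) = Finsupp.single ⟨e, he⟩ q := by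
  classical
  ext e'
  simp [relProj, Finsupp.single_apply, Subtype.ext_iff]

theorem relProj_single_of_mem {e : CoverEdge x} (he : e.edge ∈ H.edges) (q : ℚ) :
    relProj H x (Finsupp.single e q) = 0 := by
  ext e'
  have hne : e ≠ e'.1 := by
    rintro rfl
    exact e'.2 he
  simp [relProj, hne]

theorem relProj_translate (g : PathClass x x) (c : Chain1 x) :
    relProj H x (Finsupp.lmapDomain ℚ ℚ (CoverEdge.translate g) c) =
      translate g (relProj H x c) := by
  induction c using Finsupp.induction_linear with
  | zero => simp
  | add c d hc hd => simp only [map_add, hc, hd]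
  | single e q =>
    rw [Finsupp.lmapDomain_apply, Finsupp.mapDomain_single]
    by_cases he : e.edge ∈ H.edges
    · rw [relProj_single_of_mem he, relProj_single_of_mem (by exact he), map_zero]
    · rw [relProj_single_of_notMem he, relProj_single_of_notMem (by exact he)]
      exact (translate_single g (⟨e, he⟩ : RelEdge H x) q).symm

theorem relMap_translate (f : GraphMap V) (hx : f.obj x = x) (g : PathClass x x)
    (c : RelChain H x) :
    relMap H f hx (translate g c) = translate (groupMap f hx g) (relMap H f hx c) := by
  induction c using Finsupp.induction_linear with
  | zero => simp
  | add c d hc hd => simp only [map_add, hc, hd]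
  | single e q =>
    have hpath := relProj_translate (H := H) (groupMap f hx g)
      (pathChain (liftPath f hx e.1.path) (f.map e.1.edge))
    rw [← pathChain_comp, ← liftPath_group_comp] at hpath
    simp only [relMap, translate_single, LinearMap.comp_apply, relIncl, Finsupp.lmapDomain_apply,
      Finsupp.mapDomain_single, chainMap, Finsupp.linearCombination_single, map_smul]
    exact congrArg (q • ·) hpath

theorem relProj_pathChain_eq_zero {a b : V} (s : PathClass x a) (p : EdgePath a b)
    (hp : H.ContainsPath p) : relProj H x (pathChain s p) = 0 := by
  induction p with
  | nil => simp [pathChain]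
  | forward p e ih => rw [pathChain, map_add, ih hp.1, relProj_single_of_mem hp.2, add_zero]
  | backward p e ih => rw [pathChain, map_sub, ih hp.1, relProj_single_of_mem hp.2, sub_zero]

theorem relMap_relProj (f : GraphMap V) (hx : f.obj x = x) (hH : H.IsInvariant f)
    (c : Chain1 x) : relMap H f hx (relProj H x c) = relProj H x (chainMap f hx c) := by
  induction c using Finsupp.induction_linear with
  | zero => simp
  | add c d hc hd => simp only [map_add, hc, hd]
  | single e q =>
    by_cases he : e.edge ∈ H.edges
    · rw [relProj_single_of_mem he, map_zero, chainMap, Finsupp.linearCombination_single, map_smul,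
        relProj_pathChain_eq_zero _ _ (hH.2 _ _ _ he), smul_zero]
    · simp [relProj_single_of_notMem he, relMap, relIncl]

variable {f : GraphMap V} {hx : f.obj x = x}

theorem relMap_eq_self_of_isFixedPathChain (hH : H.IsInvariant f) {ρ : RelChain H x}
    (hρ : IsFixedPathChain f hx ρ) : relMap H f hx ρ = ρ := by
  obtain ⟨w, w', c, -, hw, hw', hc, rfl⟩ := hρ
  rw [relMap_relProj f hx hH, chainMap_eq_self f hx hw hw' hc]

theorem ChainFlareCondition.exists_relMap_eq_self {Vh Vqf : Submodule ℚ (RelChain H x)}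
    (hcf : ChainFlareCondition f hx Vh Vqf) (hH : H.IsInvariant f) :
    ∃ ρ : RelChain H x, relMap H f hx ρ = ρ ∧
      Vqf ≤ Submodule.span ℚ (Set.range fun g : PathClass x x => translate g ρ) := by
  by_cases hqf : Vqf = ⊥
  · exact ⟨0, map_zero _, hqf ▸ bot_le⟩
  · obtain ⟨ρ, hρ, hspan⟩ := hcf.quasi_fixed hqf
    exact ⟨ρ, relMap_eq_self_of_isFixedPathChain hH hρ.1, hspan⟩

end RelativeChains

section ChainSpaces

variable {V : Type u} [Quiver.{v} V] {x : V} {H : Subgraph V}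

theorem chainInner_eq_re_inner (c d : RelChain H x) :
    chainInner c d = (inner ℂ (ratToL2 c) (ratToL2 d)).re := by
  rw [inner_ratToL2, Complex.ofReal_re, chainInner]

theorem chainNorm_eq_norm (c : RelChain H x) : chainNorm c = ‖ratToL2 c‖ := by
  rw [chainNorm, chainInner_eq_re_inner, norm_eq_sqrt_re_inner (𝕜 := ℂ), RCLike.re_eq_complex_re]

theorem angleNhd_eq_angleCone (θ : ℝ) (W : Submodule ℚ (RelChain H x)) :
    angleNhd θ W = angleCone θ W := by
  simp only [angleNhd, angleCone, chainInner_eq_re_inner, chainNorm_eq_norm, gt_iff_lt]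

theorem ChainFlareCondition.exists_flare {f : GraphMap V} {hx : f.obj x = x}
    {Vh Vqf : Submodule ℚ (RelChain H x)} (hcf : ChainFlareCondition f hx Vh Vqf) :
    ∃ lam θ : ℝ, 1 < lam ∧ θ < 1 ∧ ∀ c ∈ orbitSet (relMap H f hx) (angleCone θ Vh),
      lam * ‖ratToL2 (relMap H f hx c)‖ ≤
        max ‖ratToL2 (relMap H f hx (relMap H f hx c))‖ ‖ratToL2 c‖ := by
  obtain ⟨lam, θ, hlam, -, hθ, hflare⟩ := hcf.flare
  simp only [angleNhd_eq_angleCone, chainNorm_eq_norm] at hflare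
  exact ⟨lam, θ, hlam, hθ, hflare⟩

end ChainSpaces

end ChainFlare

open ChainFlare in
theorem mainTheorem4_general {G ι : Type*} [Group G] [MulAction G ι] [IsCancelSMul G ι]
    [Finite (MulAction.orbitRel.Quotient G ι)] {φ : G → G} (hφ : Function.Bijective φ)
    {L : (ι →₀ ℚ) →ₗ[ℚ] (ι →₀ ℚ)} (hL : ∀ g c, L (translate g c) = translate (φ g) (L c))
    {Vh Vqf : Submodule ℚ (ι →₀ ℚ)} (hVh : ∀ g : G, ∀ c ∈ Vh, translate g c ∈ Vh)
    (hVqf : ∀ g : G, ∀ c ∈ Vqf, translate g c ∈ Vqf) (hsup : Vh ⊔ Vqf = ⊤)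
    {lam θ : ℝ} (hlam : 1 < lam) (hθ : θ < 1)
    (hflare : ∀ c ∈ orbitSet L (angleCone θ Vh),
      lam * ‖ratToL2 (L c)‖ ≤ max ‖ratToL2 (L (L c))‖ ‖ratToL2 c‖)
    {ρ : ι →₀ ℚ} (hρ : L ρ = ρ)
    (hqf : Vqf ≤ Submodule.span ℚ (Set.range fun g : G => translate g ρ)) :
    (∃! A : L2 ι →L[ℂ] L2 ι, ∀ c, A (ratToL2 c) = ratToL2 (L c)) ∧
    ∀ A : L2 ι →L[ℂ] L2 ι, (∀ c, A (ratToL2 c) = ratToL2 (L c)) →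
      ∀ ν : ℝ, 1 ≤ ν → ν < lam → (l2Span Vqf : Set (L2 ι)) = subspaceE A ν ∩ subspaceF A ν⁻¹ := by
  refine ⟨?_, fun A hA ν hν hνlam => ?_⟩
  · obtain ⟨A, hA⟩ := exists_clm_of_equivariant hφ.injective hL
    exact ⟨A, hA, fun B hB => clm_ext_ratToL2 fun c => (hB c).trans (hA c).symm⟩
  have hlam0 : 0 < lam := one_pos.trans hlam
  have hslow : subspaceE A ν ∩ subspaceF A ν⁻¹ ⊆ slowForward A lam ⊓ slowBackward A lam :=
    Set.inter_subset_inter (subspaceE_subset_slowForward hlam0 hνlam)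
      (subspaceF_subset_slowBackward hlam0 hνlam)
  have hbounded : (l2Span Vqf : Set (L2 ι)) ⊆ subspaceE A ν ∩ subspaceF A ν⁻¹ :=
    l2Span_subset hφ.surjective hL hA hρ hqf hν
  exact hbounded.antisymm <| hslow.trans <|
    slow_le_l2Span hlam hθ hflare hA hVh hVqf hsup (hbounded.trans hslow)

theorem mainTheorem4 {V : Type u} [Quiver.{v} V] [Finite V] [∀ a b : V, Finite (a ⟶ b)]
    (x : V) (hconn : ∀ a : V, Nonempty (ChainFlare.PathClass x a))
    (f : ChainFlare.GraphMap V) (hf : f.IsHomotopyEquiv) (hx : f.obj x = x)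
    (H : ChainFlare.Subgraph V) (hH : H.IsInvariant f)
    (Vh Vqf : Submodule ℚ (ChainFlare.RelChain H x))
    (hcf : ChainFlare.ChainFlareCondition f hx Vh Vqf) :
    (∃! A : ChainFlare.L2Chain H x →L[ℂ] ChainFlare.L2Chain H x,
      ChainFlare.IsL2Extension f hx A) ∧
    ∃ lam : ℝ, 1 < lam ∧
      ∀ A : ChainFlare.L2Chain H x →L[ℂ] ChainFlare.L2Chain H x,
        ChainFlare.IsL2Extension f hx A →
        ∀ ν : ℝ, 1 ≤ ν → ν < lam →
          (ChainFlare.l2Closure Vqf : Set (ChainFlare.L2Chain H x)) =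
            ChainFlare.subspaceE A ν ∩ ChainFlare.subspaceF A ν⁻¹ := by
  obtain ⟨lam, θ, hlam, hθ, hflare⟩ := hcf.exists_flare
  obtain ⟨ρ, hρ, hqf⟩ := hcf.exists_relMap_eq_self hH
  obtain ⟨hextension, heq⟩ := mainTheorem4_general (ChainFlare.groupMap_bijective f hx hf)
    (ChainFlare.relMap_translate f hx) hcf.invariant_h hcf.invariant_qf hcf.sum_eq_top hlam hθ
    hflare hρ hqf
  exact ⟨hextension, lam, hlam, heq⟩

end
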